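/- A distribution function (df) is a non-decreasing, right-continuous function $F:\mathbb R\to[0,1]$ with limits $0$ at $-\infty$ and $1$ at $+\infty$; let $r(F)=\sup\{x: F(x)<1\}\in(-\infty,\infty]$ and $F^{-}(y)=\inf\{x: F(x)\ge y\}$. For a non-degenerate df $G$, write $F\in D(G)$ if there are $a_n>0$, $b_n\in\mathbb R$ with $$\lim_{n\to\infty}F^n(a_nx+b_n)=G(x)\quad\text{at every continuity point } x \text{ of } G;\qquad (1)$$ such $a_n,b_n$ are called norming constants for $(F,G)$ (it suffices that they are defined, with $a_n>0$, for all large $n$). Let $\Phi_\alpha(x)=\exp(-x^{-\alpha})$ for $x>0$ and $0$ for $x\le 0$; $\Psi_\alpha(x)=\exp(-|x|^{\alpha})$ for $x<0$ and $1$ for $x\ge 0$; $\Lambda(x)=\exp(-e^{-x})$; here $\alpha>0$. An auxiliary function of $F$ is a function $v$, positive on $(-\infty,r(F))$, such that $\lim_{t\uparrow r(F)}\frac{1-F(t+v(t)x)}{1-F(t)}=e^{-x}$ for all $x\ge 0$. Theorem. Let $F$ be an absolutely continuous df with pdf $f$, let $k\ge 1$ be an integer, and let $H_k(x)=1-(1-F(x))^k$,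 $x\in\mathbb R$. Then $H_k$ is an absolutely continuous df with pdf $k(1-F)^{k-1}f$; moreover $H_k'(x)=k(1-F(x))^{k-1}f(x)$ at every $x$ with $F'(x)=f(x)$, hence for almost every $x$; and $r(H_k)=r(F)$. Further: (a) If $F\in D(\Phi_\alpha)$, then $r(H_k)=r(F)=\infty$ and $H_k\in D(\Phi_{k\alpha})$, with norming constants $a_n=F^{-}\left(1-(1/n)^{1/k}\right)$, $b_n=0$. (b) If $F\in D(\Psi_\alpha)$, then $r(H_k)=r(F)<\infty$ and $H_k\in D(\Psi_{k\alpha})$, with norming constants $a_n=r(F)-F^{-}\left(1-(1/n)^{1/k}\right)$, $b_n=r(F)$. (c) If $F\in D(\Lambda)$, then $r(H_k)=r(F)$ and $H_k\in D(\Lambda)$; $F$ has an auxiliary function, and for every auxiliary function $v$ of $F$, $b_n=H_k^{-}(1-1/n)$ and $a_n=v(b_n)/k$ are norming constants for $(H_k,\Lambda)$. -/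

import Mathlib

open Filter Topology MeasureTheory

namespace ExtremeValue

noncomputable section

/-- `F` is the distribution function (df) of a real random variable. -/
structure IsDF (F : ℝ → ℝ) : Prop where
  mono : Monotone F
  rightCont : ∀ x, ContinuousWithinAt F (Set.Ici x) x
  tendsto_atBot : Tendsto F atBot (𝓝 0)
  tendsto_atTop : Tendsto F atTop (𝓝 1)

/-- `f` is a probability density function of the df `F`, that is, `F` is absolutely continuous
with density `f`. -/
structure IsPDF (F f : ℝ → ℝ) : Prop where
  measurable : Measurable f
  nonneg : ∀ x, 0 ≤ f x
  integrable : Integrable f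
  eq_integral : ∀ x, F x = ∫ t in Set.Iic x, f t

/-- The right extremity `r(F) = sup {x : F x < 1}`, an extended real number. -/
def rightEnd (F : ℝ → ℝ) : EReal := sSup ((fun x : ℝ => (x : EReal)) '' {x : ℝ | F x < 1})

/-- The generalised inverse `F⁻(y) = inf {x : F x ≥ y}`; for a df `F` the infimum is a genuine
real number whenever `0 < y < 1`. -/
def quantile (F : ℝ → ℝ) (y : ℝ) : ℝ := sInf {x : ℝ | y ≤ F x}

/-- `F (a n * x + b n) ^ n → G x` at all continuity points `x` of `G`, with norming constants
`a n > 0` and `b n`. Positivity is asked for all large `n`: explicit constants such as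
`quantile F (1 - 1 / n)` are meaningful only from some `n` on, and finitely many terms do not
affect the limit. -/
def IsNormedLimit (F G : ℝ → ℝ) (a b : ℕ → ℝ) : Prop :=
  (∀ᶠ n in atTop, 0 < a n) ∧
    ∀ x, ContinuousAt G x → Tendsto (fun n : ℕ => F (a n * x + b n) ^ n) atTop (𝓝 (G x))

/-- The max domain of attraction of the nondegenerate df `G` under linear normalization. -/
def maxDomain (G : ℝ → ℝ) : Set (ℝ → ℝ) :=
  {F | IsDF F ∧ IsDF G ∧ (∃ x, 0 < G x ∧ G x < 1) ∧ ∃ a b : ℕ → ℝ, IsNormedLimit F G a b}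

/-- The Fréchet law with exponent `α`. -/
def frechet (α : ℝ) (x : ℝ) : ℝ := if 0 < x then Real.exp (-x ^ (-α)) else 0

/-- The Weibull law with exponent `α`. -/
def weibull (α : ℝ) (x : ℝ) : ℝ := if x < 0 then Real.exp (-|x| ^ α) else 1

/-- The Gumbel law. -/
def gumbel (x : ℝ) : ℝ := Real.exp (-Real.exp (-x))

/-- The filter of real `t` tending to `r(F)` from the left (`t → ∞` if `r(F) = ∞`). -/
def toRightEnd (F : ℝ → ℝ) : Filter ℝ :=
  comap (fun t : ℝ => (t : EReal)) (𝓝[<] rightEnd F)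

/-- `v` is an auxiliary function of `F`: it is positive to the left of `r(F)` and
`(1 - F (t + v t * x)) / (1 - F t) → exp (-x)` as `t ↑ r(F)`, for every `x ≥ 0`. -/
def IsAuxiliary (F v : ℝ → ℝ) : Prop :=
  (∀ t : ℝ, (t : EReal) < rightEnd F → 0 < v t) ∧
    ∀ x : ℝ, 0 ≤ x →
      Tendsto (fun t => (1 - F (t + v t * x)) / (1 - F t)) (toRightEnd F) (𝓝 (Real.exp (-x)))

/-- `H_k = 1 - (1 - F) ^ k`. -/
def powTail (k : ℕ) (F : ℝ → ℝ) (x : ℝ) : ℝ := 1 - (1 - F x) ^ k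

/-- `k (1 - F) ^ (k - 1) f`, for `k ≥ 1`. -/
def powTailDensity (k : ℕ) (F f : ℝ → ℝ) (x : ℝ) : ℝ := k * (1 - F x) ^ (k - 1) * f x

end

end ExtremeValue

open ExtremeValue

/-!
A df `F` with a density is continuous, so that `F (quantile F y) = y` for `0 < y < 1`. Write
`S = 1 - F` for its tail and `H = powTail k F`, whose tail is `S ^ k`.

**Density.** `F` is absolutely continuous on bounded intervals with `F' = f` almost everywhere, by
Lebesgue's differentiation theorem. Hence `H`, a polynomial in `F`, is absolutely continuous, and
the fundamental theorem of calculus for absolutely continuous functions (`isPDF_powTail`) recovers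
it from its almost everywhere derivative `k (1 - F) ^ (k - 1) f`.

**Domains of attraction.** On the set `J` where `0 < G < 1`, the relation `F ∈ D(G)` reads
`n * S (a n * x + b n) → τ x` with `τ = -log G` (`IsNormedLimit.tailLimit`). As `S` is monotone and
`τ` continuous and strictly decreasing on `J`, the values of the tail and the normalised arguments
determine each other asymptotically (`TailLimit.tendsto_of_tendsto`, `TailLimit.tendsto_arg`). Two
uses of this carry the proof.

* With `n = ⌊1 / S t⌋₊`, every `t` at which `S t` is small satisfies `t = a n * x₁ + b n + o(a n)`,
  where `τ x₁ = 1`. So limits along `n` turn into limits of `S (y) / S (t)` as `S t → 0`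
  (`TailLimit.tendsto_ratio`).
* For the Fréchet and Weibull laws, comparing the indices `m` and `m / 2` shows that
  `a m / a (m / 2)` tends to a constant different from `1`, and that
  `(b m - b (m / 2)) / a (m / 2) → 0` (`TailLimit.tendsto_half`). Summing geometrically gives
  `b n / a n → 0` and `a n → ∞` in the Fréchet case, and `r < ∞` and `(r - b n) / a n → 0` in the
  Weibull case, where `r` is the right extremity. So the shift may be replaced by `0`, respectively
  by `r`, and the tail is regularly varying (`TailLimit.frechet_ratio`, `TailLimit.weibull_ratio`).

In the Gumbel case `v t = a ⌊1 / S t⌋₊` is an auxiliary function, and the defining limit of any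
other one at the single point `x = 1` forces it to be asymptotic to this `v`; so the limit of
`S (t + v t * x) / S t` is `exp (-x)` for negative `x` as well (`IsAuxiliary.tendsto_ratio`).

Finally, the arguments `t n` in the statement satisfy `S (t n) ^ k = 1 / n`. Hence
`n * S (y n) ^ k` is the `k`-th power of `S (y n) / S (t n)`, whose limit is known, and
exponentiation gives the limit of `H (y n) ^ n` (`tendsto_powTail_pow`).
-/

namespace ExtremeValue

/-! ### Distribution functions with a density, and their power tails -/

variable {F f : ℝ → ℝ}

lemma IsDF.le_one (hF : IsDF F) (x : ℝ) : F x ≤ 1 :=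
  hF.mono.ge_of_tendsto hF.tendsto_atTop x

lemma IsDF.nonneg (hF : IsDF F) (x : ℝ) : 0 ≤ F x :=
  hF.mono.le_of_tendsto hF.tendsto_atBot x

lemma IsDF.antitone_tail (hF : IsDF F) : Antitone fun x => 1 - F x :=
  fun _ _ h => sub_le_sub_left (hF.mono h) 1

lemma IsPDF.sub_eq_intervalIntegral (hf : IsPDF F f) (a b : ℝ) :
    F b - F a = ∫ x in a..b, f x := by
  rw [hf.eq_integral, hf.eq_integral]
  exact intervalIntegral.integral_Iic_sub_Iic hf.integrable.integrableOn
    hf.integrable.integrableOn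

lemma IsPDF.eq_add_intervalIntegral (hf : IsPDF F f) (a : ℝ) :
    F = fun x => F a + ∫ t in a..x, f t := by
  funext x
  rw [← hf.sub_eq_intervalIntegral]
  ring

lemma IsPDF.continuous (hf : IsPDF F f) : Continuous F := by
  rw [hf.eq_add_intervalIntegral 0]
  exact continuous_const.add
    (intervalIntegral.continuous_primitive (fun _ _ => hf.integrable.intervalIntegrable) 0)

lemma IsPDF.ae_hasDerivAt (hf : IsPDF F f) : ∀ᵐ x, HasDerivAt F (f x) x := by
  filter_upwards [LocallyIntegrable.ae_hasDerivAt_integral hf.integrable.locallyIntegrable]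
    with x hx
  rw [hf.eq_add_intervalIntegral 0]
  exact (hx 0).const_add _

lemma IsPDF.absolutelyContinuousOnInterval (hf : IsPDF F f) (a b : ℝ) :
    AbsolutelyContinuousOnInterval F a b := by
  rw [hf.eq_add_intervalIntegral a]
  have hc : AbsolutelyContinuousOnInterval (fun _ : ℝ => F a) a b :=
    (contDiff_const (n := 1)).contDiffOn.absolutelyContinuousOnInterval
  exact hc.add (IntervalIntegrable.absolutelyContinuousOnInterval_intervalIntegral
    hf.integrable.intervalIntegrable (by simp))

lemma absolutelyContinuousOnInterval_pow {g : ℝ → ℝ} {a b : ℝ}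
    (hg : AbsolutelyContinuousOnInterval g a b) (k : ℕ) :
    AbsolutelyContinuousOnInterval (fun x => g x ^ k) a b := by
  induction k with
  | zero =>
    simpa using (contDiff_const (n := 1) (c := (1 : ℝ))).contDiffOn.absolutelyContinuousOnInterval
  | succ k ih =>
    simp only [pow_succ]
    exact ih.mul hg

lemma IsPDF.absolutelyContinuousOnInterval_powTail (hf : IsPDF F f) (k : ℕ) (a b : ℝ) :
    AbsolutelyContinuousOnInterval (powTail k F) a b := by
  have hc : AbsolutelyContinuousOnInterval (fun _ : ℝ => (1 : ℝ)) a b :=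
    (contDiff_const (n := 1)).contDiffOn.absolutelyContinuousOnInterval
  exact hc.sub (absolutelyContinuousOnInterval_pow
    (hc.sub (hf.absolutelyContinuousOnInterval a b)) k)

lemma hasDerivAt_powTail {x : ℝ} (k : ℕ) (h : HasDerivAt F (f x) x) :
    HasDerivAt (powTail k F) (powTailDensity k F f x) x := by
  have := ((h.const_sub 1).pow k).const_sub 1
  convert! this using 1
  simp only [powTailDensity]
  ring

lemma isDF_powTail (hF : IsDF F) {k : ℕ} (hk : k ≠ 0) : IsDF (powTail k F) where
  mono x y h := sub_le_sub_left
    (pow_le_pow_left₀ (sub_nonneg.2 (hF.le_one y)) (hF.antitone_tail h) k) 1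
  rightCont x := ((hF.rightCont x).const_sub 1).pow k |>.const_sub 1
  tendsto_atBot := by
    simpa [powTail] using! ((hF.tendsto_atBot.const_sub 1).pow k).const_sub 1
  tendsto_atTop := by
    simpa [powTail, hk] using! ((hF.tendsto_atTop.const_sub 1).pow k).const_sub 1

lemma IsPDF.integrable_powTailDensity (hF : IsDF F) (hf : IsPDF F f) (k : ℕ) :
    Integrable (powTailDensity k F f) := by
  refine hf.integrable.bdd_mul (c := k)
    (((measurable_const.sub hF.mono.measurable).pow_const _).const_mul _).aestronglyMeasurable
    (ae_of_all _ fun x => ?_)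
  have h0 : 0 ≤ 1 - F x := sub_nonneg.2 (hF.le_one x)
  have h1 : (1 - F x) ^ (k - 1) ≤ 1 := pow_le_one₀ h0 (by linarith [hF.nonneg x])
  rw [Real.norm_of_nonneg (by positivity)]
  exact mul_le_of_le_one_right (by positivity) h1

/-- The powers of the tail are absolutely continuous, so the fundamental theorem of calculus
holds for them although the density need not be continuous. -/
lemma isPDF_powTail (hF : IsDF F) (hf : IsPDF F f) {k : ℕ} (hk : k ≠ 0) :
    IsPDF (powTail k F) (powTailDensity k F f) where
  measurable := (((measurable_const.sub hF.mono.measurable).pow_const _).const_mul _).mul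
    hf.measurable
  nonneg x := mul_nonneg (mul_nonneg (Nat.cast_nonneg k)
    (pow_nonneg (sub_nonneg.2 (hF.le_one x)) _)) (hf.nonneg x)
  integrable := hf.integrable_powTailDensity hF k
  eq_integral x := by
    have hlim := intervalIntegral_tendsto_integral_Iic x
      (hf.integrable_powTailDensity hF k).integrableOn tendsto_id
    have heq (a : ℝ) : ∫ t in a..x, powTailDensity k F f t = powTail k F x - powTail k F a := by
      rw [← (hf.absolutelyContinuousOnInterval_powTail k a x).integral_deriv_eq_sub]
      refine intervalIntegral.integral_congr_ae ?_
      filter_upwards [hf.ae_hasDerivAt] with t ht _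
      exact (hasDerivAt_powTail k ht).deriv.symm
    simp only [id, heq] at hlim
    refine tendsto_nhds_unique ?_ hlim
    simpa using ((isDF_powTail hF hk).tendsto_atBot).const_sub (powTail k F x)

lemma rightEnd_powTail (hF : IsDF F) {k : ℕ} (hk : k ≠ 0) :
    rightEnd (powTail k F) = rightEnd F := by
  have (x : ℝ) : powTail k F x < 1 ↔ F x < 1 := by
    have h0 : 0 ≤ 1 - F x := sub_nonneg.2 (hF.le_one x)
    rw [powTail, sub_lt_self_iff, (pow_nonneg h0 k).lt_iff_ne', pow_ne_zero_iff hk,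
      ← h0.lt_iff_ne', sub_pos]
  simp only [rightEnd, this]

/-! ### The right extremity and the quantile function of a continuous distribution function -/

lemma lt_rightEnd_iff (hF : IsDF F) (hc : Continuous F) {x : ℝ} :
    (x : EReal) < rightEnd F ↔ F x < 1 := by
  constructor
  · intro h
    obtain ⟨_, ⟨y, hy, rfl⟩, hxy⟩ := lt_sSup_iff.1 h
    exact (hF.mono (EReal.coe_lt_coe_iff.1 hxy).le).trans_lt hy
  · intro h
    have hev : ∀ᶠ y in 𝓝[>] x, F y < 1 :=
      nhdsWithin_le_nhds (hc.continuousAt.eventually_lt_const h)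
    obtain ⟨y, hy, hxy⟩ := (hev.and self_mem_nhdsWithin).exists
    exact (EReal.coe_lt_coe_iff.2 hxy).trans_le (le_sSup ⟨y, hy, rfl⟩)

lemma bot_lt_rightEnd (hF : IsDF F) : ⊥ < rightEnd F := by
  obtain ⟨x, hx⟩ := (hF.tendsto_atBot.eventually_lt_const zero_lt_one).exists
  exact (EReal.bot_lt_coe x).trans_le (le_sSup ⟨x, hx, rfl⟩)

lemma exists_eq_of_mem_Ioo (hF : IsDF F) (hc : Continuous F) {y : ℝ} (h0 : 0 < y) (h1 : y < 1) :
    ∃ x, F x = y :=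
  mem_range_of_exists_le_of_exists_ge hc
    ((hF.tendsto_atBot.eventually_lt_const h0).exists.imp fun _ h => h.le)
    ((hF.tendsto_atTop.eventually_const_lt h1).exists.imp fun _ h => h.le)

lemma apply_quantile (hF : IsDF F) (hc : Continuous F) {y : ℝ} (h0 : 0 < y) (h1 : y < 1) :
    F (quantile F y) = y := by
  obtain ⟨z, hz⟩ := exists_eq_of_mem_Ioo hF hc h0 h1
  have hbdd : BddBelow {x : ℝ | y ≤ F x} := by
    obtain ⟨w, hw⟩ := (hF.tendsto_atBot.eventually_lt_const h0).exists
    exact ⟨w, fun x hx => le_of_lt (hF.mono.reflect_lt (hw.trans_le hx))⟩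
  have hmem : quantile F y ∈ {x : ℝ | y ≤ F x} :=
    (isClosed_le continuous_const hc).csInf_mem ⟨z, hz.ge⟩ hbdd
  exact le_antisymm ((hF.mono (csInf_le hbdd hz.ge)).trans hz.le) hmem

lemma tendsto_tail_toRightEnd (hF : IsDF F) (hc : Continuous F) :
    Tendsto (fun t => 1 - F t) (toRightEnd F) (𝓝[>] 0) := by
  have hpos : ∀ᶠ t : ℝ in toRightEnd F, (t : EReal) < rightEnd F :=
    tendsto_comap.eventually (p := fun e : EReal => e < rightEnd F) self_mem_nhdsWithin
  refine tendsto_nhdsWithin_iff.2 ⟨?_, hpos.mono fun t ht =>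
    sub_pos.2 ((lt_rightEnd_iff hF hc).1 ht)⟩
  refine tendsto_order.2 ⟨fun a ha => Eventually.of_forall fun t =>
    ha.trans_le (sub_nonneg.2 (hF.le_one t)), fun ε hε => ?_⟩
  have hm : 0 < min ε 1 := by positivity
  have hm1 : min ε 1 ≤ 1 := min_le_right _ _
  obtain ⟨x, hx⟩ := exists_eq_of_mem_Ioo hF hc (y := 1 - min ε 1 / 2) (by linarith) (by linarith)
  have hxr : (x : EReal) < rightEnd F := (lt_rightEnd_iff hF hc).2 (by linarith)
  have hev : ∀ᶠ t : ℝ in toRightEnd F, (x : EReal) < (t : EReal) :=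
    tendsto_comap.eventually (nhdsWithin_le_nhds (lt_mem_nhds hxr))
  filter_upwards [hev] with t ht
  have := hF.mono (EReal.coe_lt_coe_iff.1 ht).le
  linarith [min_le_left ε 1]

/-! ### Convergence of powers and of tails -/

/-- Taking logarithms: if `(1 - s n) ^ n → g > 0` then `n * s n → -log g`, because
`(1 - s) (-log (1 - s)) ≤ s ≤ -log (1 - s)`. -/
lemma tendsto_mul_of_tendsto_one_sub_pow {s : ℕ → ℝ} {g : ℝ} (hs : ∀ n, s n ≤ 1) (hg : 0 < g)
    (h : Tendsto (fun n => (1 - s n) ^ n) atTop (𝓝 g)) :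
    Tendsto (fun n : ℕ => n * s n) atTop (𝓝 (-Real.log g)) := by
  have hlog : Tendsto (fun n : ℕ => n * -Real.log (1 - s n)) atTop (𝓝 (-Real.log g)) := by
    refine ((Real.continuousAt_log hg.ne').tendsto.comp h).neg.congr fun n => ?_
    simp [Real.log_pow]
  have hpos : ∀ᶠ n in atTop, 0 < 1 - s n := by
    filter_upwards [h.eventually_const_lt hg, eventually_ne_atTop 0] with n hn hn0
    refine lt_of_le_of_ne (sub_nonneg.2 (hs n)) fun h0 => ?_
    rw [← h0, zero_pow hn0] at hn
    exact hn.false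
  have hone : Tendsto (fun n => 1 - s n) atTop (𝓝 1) := by
    have h1 : Tendsto (fun n : ℕ => Real.log (1 - s n)) atTop (𝓝 0) := by
      have := (hlog.mul tendsto_inv_atTop_nhds_zero_nat).neg
      rw [mul_zero, neg_zero] at this
      refine this.congr' ?_
      filter_upwards [eventually_ne_atTop 0] with n hn
      have : (n : ℝ) ≠ 0 := Nat.cast_ne_zero.2 hn
      field_simp
    have h2 := (Real.continuous_exp.tendsto 0).comp h1
    rw [Real.exp_zero] at h2
    exact h2.congr' (hpos.mono fun n hn => Real.exp_log hn)
  refine tendsto_of_tendsto_of_tendsto_of_le_of_le' (by simpa only [one_mul] using hone.mul hlog)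
    hlog ?_ ?_
  · filter_upwards [hpos] with n hn
    have h1 := Real.one_sub_inv_le_log_of_pos hn
    have h2 : (1 - s n) * -Real.log (1 - s n) ≤ s n := by
      have := mul_le_mul_of_nonneg_left h1 hn.le
      rw [mul_sub, mul_inv_cancel₀ hn.ne'] at this
      linarith
    calc (1 - s n) * (n * -Real.log (1 - s n)) = n * ((1 - s n) * -Real.log (1 - s n)) := by ring
      _ ≤ n * s n := by gcongr
  · filter_upwards [hpos] with n hn
    have := Real.log_le_sub_one_of_pos hn
    gcongr
    linarith

lemma tendsto_one_sub_pow_of_tendsto_mul {s : ℕ → ℝ} {τ : ℝ}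
    (h : Tendsto (fun n : ℕ => n * s n) atTop (𝓝 τ)) :
    Tendsto (fun n => (1 - s n) ^ n) atTop (𝓝 (Real.exp (-τ))) := by
  have := Real.tendsto_one_add_pow_exp_of_tendsto (g := fun n => -s n) (t := -τ)
    (by simpa using h.neg)
  simpa [sub_eq_add_neg] using this

/-- `n * S (a n * x + b n) → τ x` for every `x` in `J`, where `a n > 0` for large `n`: the
logarithmic form of the convergence of normalised maxima, `S` being a tail `1 - F` and
`τ = -log G`. -/
structure TailLimit (S : ℝ → ℝ) (τ : ℝ → ℝ) (J : Set ℝ) (a b : ℕ → ℝ) : Prop where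
  antitone : Antitone S
  pos : ∀ᶠ n in atTop, 0 < a n
  tendsto : ∀ x ∈ J, Tendsto (fun n : ℕ => n * S (a n * x + b n)) atTop (𝓝 (τ x))

lemma IsNormedLimit.tailLimit {F G τ : ℝ → ℝ} {J : Set ℝ} {a b : ℕ → ℝ} (hF : IsDF F)
    (h : IsNormedLimit F G a b) (hJ : IsOpen J) (hτ : ContinuousOn τ J)
    (hG : ∀ x ∈ J, G x = Real.exp (-τ x)) :
    TailLimit (fun x => 1 - F x) τ J a b where
  antitone := hF.antitone_tail
  pos := h.1
  tendsto x hx := by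
    have hGc : ContinuousAt G x := by
      have : ContinuousAt (fun y => Real.exp (-τ y)) x :=
        ((hτ.continuousAt (hJ.mem_nhds hx)).neg).rexp
      exact this.congr (eventually_of_mem (hJ.mem_nhds hx) fun y hy => (hG y hy).symm)
    have h1 := h.2 x hGc
    rw [hG x hx] at h1
    have := tendsto_mul_of_tendsto_one_sub_pow (s := fun n => 1 - F (a n * x + b n))
      (fun n => sub_le_self _ (hF.nonneg _)) (Real.exp_pos _) (by simpa using h1)
    simpa using this

section TailLimit

variable {S τ : ℝ → ℝ} {J : Set ℝ} {a b : ℕ → ℝ} {ι : Type*} {l : Filter ι} {N : ι → ℕ}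

/-- Monotonicity of `S` and continuity of `τ` make the convergence continuous: the argument may
vary along with the index. -/
lemma TailLimit.tendsto_of_tendsto (h : TailLimit S τ J a b) (hJ : IsOpen J)
    (hτ : ContinuousOn τ J) (hN : Tendsto N l atTop) {x : ι → ℝ} {x₀ : ℝ} (hx₀ : x₀ ∈ J)
    (hx : Tendsto x l (𝓝 x₀)) :
    Tendsto (fun i => N i * S (a (N i) * x i + b (N i))) l (𝓝 (τ x₀)) := by
  have hc := hτ.continuousAt (hJ.mem_nhds hx₀)
  have hpos := hN.eventually h.pos
  refine tendsto_order.2 ⟨fun c hlt => ?_, fun c hlt => ?_⟩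
  · have hev : ∀ᶠ y in 𝓝[>] x₀, c < τ y ∧ y ∈ J :=
      nhdsWithin_le_nhds ((hc.eventually_const_lt hlt).and (hJ.mem_nhds hx₀))
    obtain ⟨y, ⟨hy, hyJ⟩, hxy⟩ := (hev.and self_mem_nhdsWithin).exists
    filter_upwards [hpos, hx.eventually_lt_const hxy,
      hN.eventually ((h.tendsto y hyJ).eventually_const_lt hy)] with i ha hi hlim
    refine hlim.trans_le (mul_le_mul_of_nonneg_left (h.antitone ?_) (Nat.cast_nonneg _))
    gcongr
  · have hev : ∀ᶠ y in 𝓝[<] x₀, τ y < c ∧ y ∈ J :=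
      nhdsWithin_le_nhds ((hc.eventually_lt_const hlt).and (hJ.mem_nhds hx₀))
    obtain ⟨y, ⟨hy, hyJ⟩, hxy⟩ := (hev.and self_mem_nhdsWithin).exists
    filter_upwards [hpos, hx.eventually_const_lt hxy,
      hN.eventually ((h.tendsto y hyJ).eventually_lt_const hy)] with i ha hi hlim
    refine lt_of_le_of_lt (mul_le_mul_of_nonneg_left (h.antitone ?_) (Nat.cast_nonneg _)) hlim
    gcongr

/-- The converse of `TailLimit.tendsto_of_tendsto`, which plays the part of the convergence of
types theorem: the values of the tail determine the normalised arguments asymptotically. -/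
lemma TailLimit.tendsto_arg (h : TailLimit S τ J a b) (hJ : IsOpen J)
    (hτ : StrictAntiOn τ J) (hN : Tendsto N l atTop) {y : ι → ℝ} {x₀ : ℝ} (hx₀ : x₀ ∈ J)
    (hy : Tendsto (fun i => N i * S (y i)) l (𝓝 (τ x₀))) :
    Tendsto (fun i => (y i - b (N i)) / a (N i)) l (𝓝 x₀) := by
  have hpos := hN.eventually h.pos
  refine tendsto_order.2 ⟨fun c hlt => ?_, fun c hlt => ?_⟩
  · have hev : ∀ᶠ z in 𝓝[<] x₀, c < z ∧ z ∈ J :=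
      nhdsWithin_le_nhds ((lt_mem_nhds hlt).and (hJ.mem_nhds hx₀))
    obtain ⟨z, ⟨hcz, hzJ⟩, hzx⟩ := (hev.and self_mem_nhdsWithin).exists
    obtain ⟨m, hm1, hm2⟩ := exists_between (hτ hzJ hx₀ hzx)
    filter_upwards [hpos, hy.eventually_lt_const hm1,
      hN.eventually ((h.tendsto z hzJ).eventually_const_lt hm2)] with i ha h1 h2
    have := h.antitone.reflect_lt (lt_of_mul_lt_mul_left (h1.trans h2) (Nat.cast_nonneg _))
    rw [lt_div_iff₀ ha]
    nlinarith
  · have hev : ∀ᶠ z in 𝓝[>] x₀, z < c ∧ z ∈ J :=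
      nhdsWithin_le_nhds ((gt_mem_nhds hlt).and (hJ.mem_nhds hx₀))
    obtain ⟨z, ⟨hcz, hzJ⟩, hzx⟩ := (hev.and self_mem_nhdsWithin).exists
    obtain ⟨m, hm1, hm2⟩ := exists_between (hτ hx₀ hzJ hzx)
    filter_upwards [hpos, hy.eventually_const_lt hm2,
      hN.eventually ((h.tendsto z hzJ).eventually_lt_const hm1)] with i ha h1 h2
    have := h.antitone.reflect_lt (lt_of_mul_lt_mul_left (h2.trans h1) (Nat.cast_nonneg _))
    rw [div_lt_iff₀ ha]
    nlinarith

/-- Changing the shift by `o(a n)` does not change the limit. -/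
lemma TailLimit.congr_shift (h : TailLimit S τ J a b) (hJ : IsOpen J) (hτ : ContinuousOn τ J)
    {b' : ℕ → ℝ} (hb : Tendsto (fun n => (b' n - b n) / a n) atTop (𝓝 0)) :
    TailLimit S τ J a b' where
  antitone := h.antitone
  pos := h.pos
  tendsto x hx := by
    have := h.tendsto_of_tendsto hJ hτ tendsto_id hx
      (x := fun n => x + (b' n - b n) / a n) (by simpa using hb.const_add x)
    refine this.congr' ?_
    filter_upwards [h.pos] with n hn
    simp only [id]
    congr 2
    field_simp
    ring

/-- Comparison of the norming constants at `n` and at `n / 2`, for a law whose `τ` satisfies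
`τ (μ * x) = τ x / 2`. -/
lemma TailLimit.tendsto_half (h : TailLimit S τ J a b) (hJ : IsOpen J) (hτ : StrictAntiOn τ J)
    {μ : ℝ} (hμJ : ∀ x ∈ J, μ * x ∈ J) (hμ : ∀ x ∈ J, τ (μ * x) = τ x / 2)
    {x₁ : ℝ} (hx₁ : x₁ ∈ J) (h2x₁ : 2 * x₁ ∈ J) (hne : x₁ ≠ 0) :
    Tendsto (fun m => a m / a (m / 2)) atTop (𝓝 μ) ∧
      Tendsto (fun m => (b m - b (m / 2)) / a (m / 2)) atTop (𝓝 0) := by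
  have hN : Tendsto (fun m : ℕ => m / 2) atTop atTop := Nat.tendsto_div_const_atTop two_ne_zero
  have hhalf : Tendsto (fun m : ℕ => ((m / 2 : ℕ) : ℝ) / m) atTop (𝓝 (1 / 2)) := by
    have := (tendsto_nat_floor_mul_div_atTop (R := ℝ) (a := 1 / 2) (by norm_num)).comp
      (tendsto_natCast_atTop_atTop (R := ℝ))
    refine this.congr fun m => ?_
    have : ⌊(1 / 2 : ℝ) * m⌋₊ = m / 2 := by
      rw [one_div_mul_eq_div]
      exact_mod_cast Nat.floor_div_eq_div (K := ℝ) m 2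
    simp only [Function.comp_apply, this]
  have key (x : ℝ) (hx : x ∈ J) :
      Tendsto (fun m => (a m * x + b m - b (m / 2)) / a (m / 2)) atTop (𝓝 (μ * x)) := by
    refine h.tendsto_arg hJ hτ hN (hμJ x hx) ?_
    rw [hμ x hx, ← one_div_mul_eq_div]
    refine (hhalf.mul (h.tendsto x hx)).congr' ?_
    filter_upwards [eventually_ne_atTop 0] with m hm
    have : (m : ℝ) ≠ 0 := Nat.cast_ne_zero.2 hm
    field_simp
  have k1 := key _ hx₁
  have k2 := key _ h2x₁
  constructor
  · have := (k2.sub k1).div_const x₁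
    rw [show (μ * (2 * x₁) - μ * x₁) / x₁ = μ by field_simp; ring] at this
    refine this.congr fun m => ?_
    rw [← sub_div, div_right_comm]
    congr 1
    field_simp
    ring
  · have := (k1.const_mul 2).sub k2
    rw [show 2 * (μ * x₁) - μ * (2 * x₁) = 0 by ring] at this
    refine this.congr fun m => ?_
    rw [mul_div_assoc', ← sub_div]
    congr 1
    ring

/-- The index attached to a small tail value `s` so that `n * s` is close to `1`. -/
lemma tendsto_floor_inv {s : ι → ℝ} (hs : Tendsto s l (𝓝[>] 0)) :
    Tendsto (fun i => ⌊(s i)⁻¹⌋₊) l atTop ∧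
      Tendsto (fun i => (⌊(s i)⁻¹⌋₊ : ℝ) * s i) l (𝓝 1) := by
  have hinv : Tendsto (fun i => (s i)⁻¹) l atTop := tendsto_inv_nhdsGT_zero.comp hs
  refine ⟨tendsto_nat_floor_atTop.comp hinv, ?_⟩
  refine ((tendsto_nat_floor_div_atTop (R := ℝ)).comp hinv).congr fun i => ?_
  simp

/-- With `n = ⌊1 / S t⌋₊`, an argument `t` at which `S t` is small is `a n * x₁ + b n` up to
`o(a n)`, where `τ x₁ = 1`. -/
lemma TailLimit.tendsto_arg_floor (h : TailLimit S τ J a b) (hJ : IsOpen J)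
    (hτ : StrictAntiOn τ J) {x₁ : ℝ} (hx₁ : x₁ ∈ J) (hτ₁ : τ x₁ = 1) {t : ι → ℝ}
    (ht : Tendsto (fun i => S (t i)) l (𝓝[>] 0)) :
    Tendsto (fun i => (t i - b ⌊(S (t i))⁻¹⌋₊) / a ⌊(S (t i))⁻¹⌋₊) l (𝓝 x₁) :=
  have hN := tendsto_floor_inv ht
  h.tendsto_arg hJ hτ hN.1 hx₁ (by simpa only [hτ₁] using hN.2)

/-- Passage from the sequence of norming constants to arbitrary arguments `t` with `S t → 0`. -/
lemma TailLimit.tendsto_ratio (h : TailLimit S τ J a b) (hJ : IsOpen J) (hτ : ContinuousOn τ J)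
    {t y : ι → ℝ} (ht : Tendsto (fun i => S (t i)) l (𝓝[>] 0)) {x : ℝ} (hx : x ∈ J)
    (hy : Tendsto (fun i => (y i - b ⌊(S (t i))⁻¹⌋₊) / a ⌊(S (t i))⁻¹⌋₊) l (𝓝 x)) :
    Tendsto (fun i => S (y i) / S (t i)) l (𝓝 (τ x)) := by
  obtain ⟨hN, hN1⟩ := tendsto_floor_inv ht
  have h2 := (h.tendsto_of_tendsto hJ hτ hN hx hy).div hN1 one_ne_zero
  rw [div_one] at h2
  refine h2.congr' ?_
  filter_upwards [hN.eventually h.pos, hN.eventually (eventually_ne_atTop 0)] with i ha hn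
  have : (⌊(S (t i))⁻¹⌋₊ : ℝ) ≠ 0 := Nat.cast_ne_zero.2 hn
  rw [Pi.div_apply, mul_div_mul_left _ _ this, mul_div_cancel₀ _ ha.ne', sub_add_cancel]

end TailLimit

/-- A recursion `w n ≤ c * w (n / 2) + o(1)` with `c < 1` forces `w n → 0`. -/
lemma tendsto_zero_of_le_half {w : ℕ → ℝ} (hw : ∀ᶠ n in atTop, 0 ≤ w n) {c : ℝ} (hc0 : 0 ≤ c)
    (hc1 : c < 1) (h : ∀ ε > 0, ∀ᶠ n in atTop, w n ≤ c * w (n / 2) + ε) :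
    Tendsto w atTop (𝓝 0) := by
  have hN : Tendsto (fun m : ℕ => m / 2) atTop atTop := Nat.tendsto_div_const_atTop two_ne_zero
  refine tendsto_order.2 ⟨fun d hd => hw.mono fun n hn => hd.trans_le hn, fun d hd => ?_⟩
  set ε := d / 3 * (1 - c) with hε_def
  have hε : 0 < ε := mul_pos (by positivity) (sub_pos.2 hc1)
  have hεc : c * (d / 3) + ε = d / 3 := by rw [hε_def]; ring
  -- `w` is bounded by the maximum of its initial segment, up to `ε / (1 - c) = d / 3`
  obtain ⟨M, hM0, hM⟩ : ∃ M, 0 ≤ M ∧ ∀ n, w n ≤ M + d / 3 := by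
    obtain ⟨n₀, hn₀⟩ := eventually_atTop.1 (h ε hε)
    refine ⟨∑ i ∈ Finset.range (n₀ + 1), |w i|, by positivity, fun n => ?_⟩
    induction n using Nat.strong_induction_on with
    | _ n ih =>
      rcases le_or_gt n n₀ with hn | hn
      · have := Finset.single_le_sum (f := fun i => |w i|) (fun i _ => abs_nonneg _)
          (Finset.mem_range.2 (Nat.lt_succ_of_le hn))
        linarith [le_abs_self (w n)]
      · have h1 := hn₀ n hn.le
        have h2 := mul_le_mul_of_nonneg_left (ih (n / 2) (by omega)) hc0
        have h3 : c * ∑ i ∈ Finset.range (n₀ + 1), |w i| ≤ ∑ i ∈ Finset.range (n₀ + 1), |w i| :=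
          mul_le_of_le_one_left (by positivity) hc1.le
        linarith
  -- each further use of the recursion shrinks the bound `M` by the factor `c`
  have hj (j : ℕ) : ∀ᶠ n in atTop, w n ≤ c ^ j * M + d / 3 := by
    induction j with
    | zero => exact Eventually.of_forall fun n => by simpa using hM n
    | succ j ih =>
      filter_upwards [h ε hε, hN.eventually ih] with n h1 h2
      have h3 := mul_le_mul_of_nonneg_left h2 hc0
      rw [pow_succ']
      linarith
  have hlim : Tendsto (fun j : ℕ => c ^ j * M) atTop (𝓝 0) := by
    simpa using (tendsto_pow_atTop_nhds_zero_of_lt_one hc0 hc1).mul_const M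
  obtain ⟨j, hjd⟩ := (hlim.eventually_lt_const (show (0 : ℝ) < d / 3 by positivity)).exists
  filter_upwards [hj j] with n hn
  linarith

/-! ### The Fréchet and Weibull laws -/

lemma frechet_of_pos (α : ℝ) {x : ℝ} (hx : 0 < x) : frechet α x = Real.exp (-x ^ (-α)) :=
  if_pos hx

lemma frechet_of_nonpos (α : ℝ) {x : ℝ} (hx : x ≤ 0) : frechet α x = 0 :=
  if_neg hx.not_gt

lemma weibull_of_neg (α : ℝ) {x : ℝ} (hx : x < 0) : weibull α x = Real.exp (-(-x) ^ α) := by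
  rw [weibull, if_pos hx, abs_of_neg hx]

lemma weibull_of_nonneg (α : ℝ) {x : ℝ} (hx : 0 ≤ x) : weibull α x = 1 :=
  if_neg hx.not_gt

lemma strictAntiOn_rpow_neg {α : ℝ} (hα : 0 < α) :
    StrictAntiOn (fun x : ℝ => x ^ (-α)) (Set.Ioi 0) :=
  fun _ hx _ _ hxy => Real.rpow_lt_rpow_of_neg hx hxy (neg_lt_zero.2 hα)

lemma continuousOn_rpow_neg (α : ℝ) : ContinuousOn (fun x : ℝ => x ^ (-α)) (Set.Ioi 0) :=
  fun x hx => (Real.continuousAt_rpow_const x (-α) (Or.inl (ne_of_gt hx))).continuousWithinAt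

lemma strictAntiOn_neg_rpow {α : ℝ} (hα : 0 < α) :
    StrictAntiOn (fun x : ℝ => (-x) ^ α) (Set.Iio 0) :=
  fun _ _ _ hy hxy => Real.rpow_lt_rpow (neg_nonneg.2 (le_of_lt hy)) (neg_lt_neg hxy) hα

lemma continuousOn_neg_rpow {α : ℝ} (hα : 0 < α) :
    ContinuousOn (fun x : ℝ => (-x) ^ α) (Set.Iio 0) :=
  (continuous_neg.rpow_const fun _ => Or.inr hα.le).continuousOn

lemma isDF_frechet {α : ℝ} (hα : 0 < α) : IsDF (frechet α) where
  mono x y hxy := by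
    rcases le_or_gt x 0 with hx | hx
    · rw [frechet_of_nonpos α hx, frechet]
      split_ifs <;> positivity
    · rw [frechet_of_pos α hx, frechet_of_pos α (hx.trans_le hxy), Real.exp_le_exp, neg_le_neg_iff]
      exact (strictAntiOn_rpow_neg hα).antitoneOn hx (hx.trans_le hxy) hxy
  rightCont x := by
    rcases lt_trichotomy x 0 with hx | rfl | hx
    · have : frechet α =ᶠ[𝓝 x] fun _ => 0 := by
        filter_upwards [gt_mem_nhds hx] with y hy using frechet_of_nonpos α (le_of_lt hy)
      exact (continuousAt_const.congr this.symm).continuousWithinAt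
    · rw [← Set.Ioi_insert, continuousWithinAt_insert_self, ContinuousWithinAt,
        frechet_of_nonpos α le_rfl]
      refine ((Real.tendsto_exp_neg_atTop_nhds_zero).comp
        (tendsto_rpow_neg_nhdsGT_zero (neg_lt_zero.2 hα))).congr' ?_
      filter_upwards [self_mem_nhdsWithin] with y hy using (frechet_of_pos α hy).symm
    · have hev : frechet α =ᶠ[𝓝 x] fun y => Real.exp (-y ^ (-α)) := by
        filter_upwards [lt_mem_nhds hx] with y hy using frechet_of_pos α hy
      have hc := (continuousOn_rpow_neg α).continuousAt (Ioi_mem_nhds hx)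
      exact (hc.neg.rexp.congr hev.symm).continuousWithinAt
  tendsto_atBot := tendsto_const_nhds.congr' <| by
    filter_upwards [eventually_le_atBot 0] with x hx using (frechet_of_nonpos α hx).symm
  tendsto_atTop := by
    have := ((tendsto_rpow_neg_atTop hα).neg).rexp
    rw [neg_zero, Real.exp_zero] at this
    refine this.congr' ?_
    filter_upwards [eventually_gt_atTop 0] with x hx using (frechet_of_pos α hx).symm

lemma isDF_weibull {α : ℝ} (hα : 0 < α) : IsDF (weibull α) where
  mono x y hxy := by
    rcases lt_or_ge y 0 with hy | hy
    · rw [weibull_of_neg α hy, weibull_of_neg α (hxy.trans_lt hy), Real.exp_le_exp, neg_le_neg_iff]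
      exact (strictAntiOn_neg_rpow hα).antitoneOn (hxy.trans_lt hy) hy hxy
    · rw [weibull_of_nonneg α hy, weibull]
      split_ifs
      · exact Real.exp_le_one_iff.2 (neg_nonpos.2 (by positivity))
      · exact le_rfl
  rightCont x := by
    rcases lt_or_ge x 0 with hx | hx
    · have hev : weibull α =ᶠ[𝓝 x] fun y => Real.exp (-(-y) ^ α) := by
        filter_upwards [gt_mem_nhds hx] with y hy using weibull_of_neg α hy
      have hc := (continuousOn_neg_rpow hα).continuousAt (Iio_mem_nhds hx)
      exact (hc.neg.rexp.congr hev.symm).continuousWithinAt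
    · exact continuousWithinAt_const.congr (fun y hy => weibull_of_nonneg α (hx.trans hy))
        (weibull_of_nonneg α hx)
  tendsto_atBot := by
    refine (Real.tendsto_exp_neg_atTop_nhds_zero.comp
      ((tendsto_rpow_atTop hα).comp tendsto_neg_atBot_atTop)).congr' ?_
    filter_upwards [eventually_lt_atBot 0] with x hx using (weibull_of_neg α hx).symm
  tendsto_atTop := tendsto_const_nhds.congr' <| by
    filter_upwards [eventually_ge_atTop 0] with x hx using (weibull_of_nonneg α hx).symm

lemma exists_frechet_mem_Ioo (α : ℝ) : ∃ x, 0 < frechet α x ∧ frechet α x < 1 :=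
  ⟨1, by simp [frechet_of_pos α one_pos, Real.exp_pos]⟩

lemma exists_weibull_mem_Ioo (α : ℝ) : ∃ x, 0 < weibull α x ∧ weibull α x < 1 :=
  ⟨-1, by simp [weibull_of_neg α neg_one_lt_zero, Real.exp_pos]⟩

/-! ### The tail in the Fréchet domain of attraction -/

section Domains

variable {S : ℝ → ℝ} {α : ℝ} {a b : ℕ → ℝ} {ι : Type*} {l : Filter ι}

/-- The norming constants grow geometrically along `n, 2n, 4n, …`, whereas the increments of the
shifts are negligible: so the shifts are negligible and the scales diverge. -/
lemma TailLimit.frechet_norming (hα : 0 < α)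
    (h : TailLimit S (fun x => x ^ (-α)) (Set.Ioi 0) a b) :
    Tendsto (fun n => b n / a n) atTop (𝓝 0) ∧ Tendsto a atTop atTop := by
  set μ : ℝ := 2 ^ α⁻¹ with hμ_def
  have hμ1 : 1 < μ := Real.one_lt_rpow one_lt_two (inv_pos.2 hα)
  have hμ0 : 0 < μ := one_pos.trans hμ1
  have hμα : μ ^ (-α) = 1 / 2 := by
    rw [hμ_def, ← Real.rpow_mul zero_le_two, mul_neg, inv_mul_cancel₀ hα.ne', Real.rpow_neg_one]
    norm_num
  obtain ⟨hA, hB⟩ := h.tendsto_half isOpen_Ioi (strictAntiOn_rpow_neg hα) (μ := μ)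
    (fun x hx => mul_pos hμ0 hx)
    (fun x hx => by rw [Real.mul_rpow hμ0.le (le_of_lt hx), hμα]; ring)
    (x₁ := 1) (by simp) (by simp) one_ne_zero
  obtain ⟨ρ, h1ρ, hρμ⟩ := exists_between hμ1
  have hρ0 : 0 < ρ := one_pos.trans h1ρ
  have hN : Tendsto (fun m : ℕ => m / 2) atTop atTop := Nat.tendsto_div_const_atTop two_ne_zero
  have hstep : ∀ᶠ m in atTop, 0 < a m ∧ 0 < a (m / 2) ∧ ρ * a (m / 2) < a m := by
    filter_upwards [h.pos, hN.eventually h.pos, hA.eventually_const_lt hρμ] with m h1 h2 h3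
    exact ⟨h1, h2, (lt_div_iff₀ h2).1 h3⟩
  constructor
  · rw [tendsto_zero_iff_abs_tendsto_zero]
    refine tendsto_zero_of_le_half (c := ρ⁻¹) (Eventually.of_forall fun n => abs_nonneg _)
      (inv_nonneg.2 hρ0.le) (inv_lt_one_of_one_lt₀ h1ρ) fun ε hε => ?_
    filter_upwards [hstep, hB.abs.eventually_lt_const (show |(0 : ℝ)| < ε by simpa)]
      with m ⟨h1, h2, h3⟩ h4
    rw [abs_div, abs_of_pos h2, div_lt_iff₀ h2] at h4
    simp only [Function.comp_apply, abs_div, abs_of_pos h1, abs_of_pos h2]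
    have h5 : |b m| ≤ |b (m / 2)| + ε * a (m / 2) := by
      have := abs_add_le (b (m / 2)) (b m - b (m / 2))
      rw [add_sub_cancel] at this
      linarith
    calc |b m| / a m ≤ (|b (m / 2)| + ε * a (m / 2)) / (ρ * a (m / 2)) := by gcongr
      _ = ρ⁻¹ * (|b (m / 2)| / a (m / 2)) + ρ⁻¹ * ε := by field_simp
      _ ≤ ρ⁻¹ * (|b (m / 2)| / a (m / 2)) + ε := by
        gcongr
        exact mul_le_of_le_one_left hε.le (inv_le_one_of_one_le₀ h1ρ.le)
  · have hinv : Tendsto (fun n => (a n)⁻¹) atTop (𝓝 0) := by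
      refine tendsto_zero_of_le_half (c := ρ⁻¹) (h.pos.mono fun n hn => (inv_pos.2 hn).le)
        (inv_nonneg.2 hρ0.le) (inv_lt_one_of_one_lt₀ h1ρ) fun ε hε => ?_
      filter_upwards [hstep] with m ⟨h1, h2, h3⟩
      have := inv_anti₀ (mul_pos hρ0 h2) h3.le
      rw [mul_inv] at this
      linarith
    have := tendsto_inv_nhdsGT_zero.comp (tendsto_nhdsWithin_iff.2
      ⟨hinv, h.pos.mono fun n hn => inv_pos.2 hn⟩)
    simpa [Function.comp_def] using this

lemma TailLimit.frechet_shift_zero (hα : 0 < α)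
    (h : TailLimit S (fun x => x ^ (-α)) (Set.Ioi 0) a b) :
    TailLimit S (fun x => x ^ (-α)) (Set.Ioi 0) a (fun _ => 0) :=
  h.congr_shift isOpen_Ioi (continuousOn_rpow_neg α) (by
    simpa [neg_div] using (h.frechet_norming hα).1.neg)

lemma TailLimit.frechet_tail_pos (hα : 0 < α)
    (h : TailLimit S (fun x => x ^ (-α)) (Set.Ioi 0) a b) (y : ℝ) : 0 < S y := by
  have h1 := (h.frechet_shift_zero hα).tendsto 1 (by simp)
  obtain ⟨n, hn, hy⟩ := ((h1.eventually_const_lt (by simp : (0 : ℝ) < 1 ^ (-α))).and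
    ((h.frechet_norming hα).2.eventually_ge_atTop y)).exists
  refine (pos_of_mul_pos_right hn (Nat.cast_nonneg n)).trans_le (h.antitone ?_)
  linarith

/-- The tail is regularly varying with exponent `-α`. -/
lemma TailLimit.frechet_ratio (hα : 0 < α)
    (h : TailLimit S (fun x => x ^ (-α)) (Set.Ioi 0) a b) {t : ι → ℝ}
    (ht : Tendsto (fun i => S (t i)) l (𝓝[>] 0)) {x : ℝ} (hx : 0 < x) :
    Tendsto (fun i => S (t i * x) / S (t i)) l (𝓝 (x ^ (-α))) := by
  have h0 := h.frechet_shift_zero hα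
  have harg := h0.tendsto_arg_floor isOpen_Ioi (strictAntiOn_rpow_neg hα) (x₁ := 1) (by simp)
    (by simp) ht
  refine h0.tendsto_ratio isOpen_Ioi (continuousOn_rpow_neg α) ht hx ?_
  simpa only [sub_zero, one_mul, div_mul_eq_mul_div] using harg.mul_const x

/-! ### The tail in the Weibull domain of attraction -/

/-- The scales decay geometrically along `n, 2n, 4n, …` and the increments of the shifts are
negligible, so `b n + ε * a n` does not increase along this sequence: it lies beyond the right
extremity. -/
lemma TailLimit.weibull_tail_nonpos (hα : 0 < α)
    (h : TailLimit S (fun x => (-x) ^ α) (Set.Iio 0) a b) {ε : ℝ} (hε : 0 < ε) :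
    ∀ᶠ n in atTop, S (b n + ε * a n) ≤ 0 := by
  set μ : ℝ := (1 / 2) ^ α⁻¹ with hμ_def
  have hμ0 : 0 < μ := by positivity
  have hμ1 : μ < 1 := Real.rpow_lt_one (by norm_num) (by norm_num) (inv_pos.2 hα)
  have hμα : μ ^ α = 1 / 2 := by
    rw [hμ_def, ← Real.rpow_mul (by norm_num), inv_mul_cancel₀ hα.ne', Real.rpow_one]
  obtain ⟨hA, hB⟩ := h.tendsto_half isOpen_Iio (strictAntiOn_neg_rpow hα) (μ := μ)
    (fun x hx => mul_neg_of_pos_of_neg hμ0 hx)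
    (fun x hx => by
      rw [← mul_neg, Real.mul_rpow hμ0.le (neg_nonneg.2 (le_of_lt hx)), hμα]; ring)
    (x₁ := -1) (by simp) (by simp) (by norm_num)
  obtain ⟨ρ, hμρ, hρ1⟩ := exists_between hμ1
  have hη : 0 < ε * (1 - ρ) := mul_pos hε (sub_pos.2 hρ1)
  have hN : Tendsto (fun m : ℕ => m / 2) atTop atTop := Nat.tendsto_div_const_atTop two_ne_zero
  obtain ⟨n₀, hn₀⟩ := eventually_atTop.1 <|
    (hN.eventually h.pos).and ((hA.eventually_lt_const hμρ).and (hB.eventually_lt_const hη))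
  have hstep (n : ℕ) (hn : n₀ ≤ n) : b (2 * n) + ε * a (2 * n) ≤ b n + ε * a n := by
    obtain ⟨h1, h2, h3⟩ := hn₀ (2 * n) (by omega)
    rw [Nat.mul_div_cancel_left n two_pos] at h1 h2 h3
    rw [div_lt_iff₀ h1] at h2 h3
    nlinarith
  filter_upwards [eventually_ge_atTop n₀, eventually_gt_atTop 0] with n hn hn1
  have hpow (j : ℕ) : b (2 ^ j * n) + ε * a (2 ^ j * n) ≤ b n + ε * a n := by
    induction j with
    | zero => simp
    | succ j ih =>
      rw [pow_succ', mul_assoc]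
      exact (hstep _ (hn.trans (Nat.le_mul_of_pos_left n (by positivity)))).trans ih
  have hm : Tendsto (fun j : ℕ => 2 ^ j * n) atTop atTop :=
    (tendsto_pow_atTop_atTop_of_one_lt one_lt_two).atTop_mul_const' hn1
  by_contra! hpos
  have h1 := (h.tendsto (-1) (by simp)).comp hm
  have h2 : Tendsto (fun j : ℕ => ((2 ^ j * n : ℕ) : ℝ) * S (b n + ε * a n)) atTop atTop :=
    ((tendsto_natCast_atTop_atTop (R := ℝ)).comp hm).atTop_mul_const hpos
  obtain ⟨j, ha, hj1, hj2⟩ := ((hm.eventually h.pos).and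
    ((h1.eventually_lt_const (by simp : (-(-1) : ℝ) ^ α < 2)).and
      (h2.eventually_ge_atTop 2))).exists
  have hle : S (b n + ε * a n) ≤ S (a (2 ^ j * n) * -1 + b (2 ^ j * n)) := by
    refine h.antitone (le_trans ?_ (hpow j))
    nlinarith
  exact absurd (mul_le_mul_of_nonneg_left hle (Nat.cast_nonneg (2 ^ j * n)))
    (not_le.2 (hj1.trans_le hj2))

/-- If `r` separates the zeros of `S` from its positive values, then it may be taken for the
shift. -/
lemma TailLimit.weibull_shift (hα : 0 < α)
    (h : TailLimit S (fun x => (-x) ^ α) (Set.Iio 0) a b) {r : ℝ} (hr : ∀ x, x < r ↔ 0 < S x) :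
    TailLimit S (fun x => (-x) ^ α) (Set.Iio 0) a (fun _ => r) := by
  refine h.congr_shift isOpen_Iio (continuousOn_neg_rpow hα)
    (tendsto_order.2 ⟨fun ε hε => ?_, fun ε hε => ?_⟩)
  · have hlim := h.tendsto _ (show ε / 2 ∈ Set.Iio (0 : ℝ) from by simp; linarith)
    have hp : 0 < (-(ε / 2)) ^ α := Real.rpow_pos_of_pos (by linarith) α
    filter_upwards [h.pos, hlim.eventually_const_lt hp] with n ha hn
    have := (hr _).2 (pos_of_mul_pos_right hn (Nat.cast_nonneg n))
    rw [lt_div_iff₀ ha]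
    nlinarith
  · filter_upwards [h.pos, h.weibull_tail_nonpos hα (half_pos hε)] with n ha hn
    have : r ≤ b n + ε / 2 * a n := le_of_not_gt fun hlt => ((hr _).1 hlt).not_ge hn
    rw [div_lt_iff₀ ha]
    nlinarith

/-- The tail is regularly varying at its right extremity `r`, with exponent `α`. -/
lemma TailLimit.weibull_ratio (hα : 0 < α)
    (h : TailLimit S (fun x => (-x) ^ α) (Set.Iio 0) a b) {r : ℝ} (hr : ∀ x, x < r ↔ 0 < S x)
    {t : ι → ℝ} (ht : Tendsto (fun i => S (t i)) l (𝓝[>] 0)) {x : ℝ} (hx : x < 0) :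
    Tendsto (fun i => S ((r - t i) * x + r) / S (t i)) l (𝓝 ((-x) ^ α)) := by
  have h0 := h.weibull_shift hα hr
  have harg := h0.tendsto_arg_floor isOpen_Iio (strictAntiOn_neg_rpow hα) (x₁ := -1) (by simp)
    (by simp) ht
  refine h0.tendsto_ratio isOpen_Iio (continuousOn_neg_rpow hα) ht hx ?_
  have := (harg.mul_const x).neg
  rw [neg_mul, one_mul, neg_neg] at this
  refine this.congr fun i => ?_
  ring

end Domains

/-! ### Auxiliary functions in the Gumbel domain of attraction -/

lemma strictAntiOn_exp_neg : StrictAntiOn (fun x : ℝ => Real.exp (-x)) Set.univ :=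
  fun _ _ _ _ h => Real.exp_lt_exp.2 (neg_lt_neg h)

lemma continuousOn_exp_neg : ContinuousOn (fun x : ℝ => Real.exp (-x)) Set.univ := by
  fun_prop

variable {a b : ℕ → ℝ} {ι : Type*} {l : Filter ι}

/-- An auxiliary function is `t ↦ a ⌊1 / (1 - F t)⌋₊`. -/
lemma TailLimit.exists_isAuxiliary (hF : IsDF F) (hc : Continuous F)
    (h : TailLimit (fun x => 1 - F x) (fun x => Real.exp (-x)) Set.univ a b) :
    ∃ v : ℝ → ℝ, IsAuxiliary F v := by
  have hS := tendsto_tail_toRightEnd hF hc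
  have harg := h.tendsto_arg_floor isOpen_univ strictAntiOn_exp_neg (x₁ := 0) trivial (by simp) hS
  have hpos := (tendsto_floor_inv hS).1.eventually h.pos
  -- the index may be too small for positivity when `t` is far from the right extremity
  refine ⟨fun t => if 0 < a ⌊(1 - F t)⁻¹⌋₊ then a ⌊(1 - F t)⁻¹⌋₊ else 1,
    fun t _ => by dsimp only; split_ifs with ha <;> [exact ha; exact one_pos], fun x _ => ?_⟩
  refine h.tendsto_ratio isOpen_univ continuousOn_exp_neg hS (x := x) trivial ?_
  have := harg.add_const x
  rw [zero_add] at this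
  refine this.congr' ?_
  filter_upwards [hpos] with t ht
  rw [if_pos ht, add_sub_right_comm, add_div, mul_div_cancel_left₀ _ ht.ne']

/-- An auxiliary function is asymptotic to `t ↦ a ⌊1 / (1 - F t)⌋₊`, which is seen from its
defining limit at `x = 1`; hence that limit holds for negative `x`, too. -/
lemma IsAuxiliary.tendsto_ratio (hF : IsDF F) (hc : Continuous F)
    (h : TailLimit (fun x => 1 - F x) (fun x => Real.exp (-x)) Set.univ a b) {v : ℝ → ℝ}
    (hv : IsAuxiliary F v) (x : ℝ) :
    Tendsto (fun t => (1 - F (t + v t * x)) / (1 - F t)) (toRightEnd F)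
      (𝓝 (Real.exp (-x))) := by
  have hS := tendsto_tail_toRightEnd hF hc
  obtain ⟨hN, hN1⟩ := tendsto_floor_inv hS
  have harg := h.tendsto_arg_floor isOpen_univ strictAntiOn_exp_neg (x₁ := 0) trivial (by simp) hS
  have h1 : Tendsto (fun t => (t + v t - b ⌊(1 - F t)⁻¹⌋₊) / a ⌊(1 - F t)⁻¹⌋₊) (toRightEnd F)
      (𝓝 1) := by
    refine h.tendsto_arg isOpen_univ strictAntiOn_exp_neg hN trivial ?_
    have := hN1.mul (hv.2 1 zero_le_one)
    rw [one_mul] at this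
    refine this.congr' ?_
    filter_upwards [hS.eventually self_mem_nhdsWithin] with t ht
    have : 1 - F t ≠ 0 := ne_of_gt ht
    field_simp
  refine h.tendsto_ratio isOpen_univ continuousOn_exp_neg hS (x := x) trivial ?_
  have := harg.add ((h1.sub harg).mul_const x)
  rw [sub_zero, one_mul, zero_add] at this
  refine this.congr fun t => ?_
  ring

lemma tendsto_toRightEnd (hF : IsDF F) (hc : Continuous F) {t : ι → ℝ}
    (ht : Tendsto (fun i => 1 - F (t i)) l (𝓝[>] 0)) : Tendsto t l (toRightEnd F) := by
  have hlt : ∀ᶠ i in l, (t i : EReal) < rightEnd F := by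
    filter_upwards [ht.eventually self_mem_nhdsWithin] with i hi
    exact (lt_rightEnd_iff hF hc).2 (sub_pos.1 hi)
  refine tendsto_comap_iff.2 (tendsto_nhdsWithin_iff.2 ⟨tendsto_order.2 ⟨fun c hcr => ?_,
    fun d hd => hlt.mono fun i hi => hi.trans hd⟩, hlt⟩)
  obtain ⟨x, hcx, hxr⟩ := EReal.lt_iff_exists_real_btwn.1 hcr
  have hx : 0 < 1 - F x := sub_pos.2 ((lt_rightEnd_iff hF hc).1 hxr)
  filter_upwards [(tendsto_nhdsWithin_iff.1 ht).1.eventually_lt_const hx] with i hi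
  exact hcx.trans (EReal.coe_lt_coe_iff.2 (hF.antitone_tail.reflect_lt hi))

/-! ### Norming constants for the power tail -/

lemma tendsto_tail_of_pow_eq (hF : IsDF F) {k : ℕ} (hk : k ≠ 0) {t : ℕ → ℝ}
    (ht : ∀ᶠ n : ℕ in atTop, (1 - F (t n)) ^ k = 1 / n) :
    Tendsto (fun n => 1 - F (t n)) atTop (𝓝[>] 0) := by
  have hk' : (0 : ℝ) < (k : ℝ)⁻¹ := by positivity
  have heq : ∀ᶠ n : ℕ in atTop, (1 / (n : ℝ)) ^ (k : ℝ)⁻¹ = 1 - F (t n) := by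
    filter_upwards [ht] with n hn
    rw [← hn, Real.pow_rpow_inv_natCast (sub_nonneg.2 (hF.le_one _)) hk]
  refine tendsto_nhdsWithin_iff.2 ⟨?_, ?_⟩
  · have := tendsto_one_div_atTop_nhds_zero_nat.rpow_const (p := (k : ℝ)⁻¹) (Or.inr hk'.le)
    rw [Real.zero_rpow hk'.ne'] at this
    exact this.congr' heq
  · filter_upwards [heq, eventually_gt_atTop 0] with n hn hn0
    rw [Set.mem_Ioi, ← hn]
    positivity

/-- If `(1 - F (t n)) ^ k = 1 / n`, then `n (1 - H_k (y n))` is the `k`-th power of the ratio of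
the tails at `y n` and `t n`. -/
lemma tendsto_powTail_pow {k : ℕ} {t y : ℕ → ℝ} {τ : ℝ}
    (ht : ∀ᶠ n : ℕ in atTop, (1 - F (t n)) ^ k = 1 / n)
    (h : Tendsto (fun n => (1 - F (y n)) / (1 - F (t n))) atTop (𝓝 τ)) :
    Tendsto (fun n => powTail k F (y n) ^ n) atTop (𝓝 (Real.exp (-τ ^ k))) := by
  refine tendsto_one_sub_pow_of_tendsto_mul ((h.pow k).congr' ?_)
  filter_upwards [ht] with n hn
  rw [div_pow, hn, one_div, div_inv_eq_mul, mul_comm]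

lemma tail_quantile_pow_eq (hF : IsDF F) (hc : Continuous F) {k : ℕ} (hk : k ≠ 0) :
    ∀ᶠ n : ℕ in atTop,
      (1 - F (quantile F (1 - (1 / (n : ℝ)) ^ (1 / (k : ℝ))))) ^ k = 1 / n := by
  filter_upwards [eventually_gt_atTop 1] with n hn
  have hn' : (1 : ℝ) < n := Nat.one_lt_cast.2 hn
  have h0 : (0 : ℝ) < (1 / (n : ℝ)) ^ (1 / (k : ℝ)) := by positivity
  have h1 : (1 / (n : ℝ)) ^ (1 / (k : ℝ)) < 1 :=
    Real.rpow_lt_one (by positivity) ((div_lt_one (by positivity)).2 hn') (by positivity)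
  rw [apply_quantile hF hc (by linarith) (by linarith), sub_sub_cancel, one_div (k : ℝ),
    Real.rpow_inv_natCast_pow (by positivity) hk]

lemma tail_quantile_powTail_pow_eq (hF : IsDF F) (hc : Continuous F) {k : ℕ} (hk : k ≠ 0) :
    ∀ᶠ n : ℕ in atTop,
      (1 - F (quantile (powTail k F) (1 - 1 / (n : ℝ)))) ^ k = 1 / n := by
  filter_upwards [eventually_gt_atTop 1] with n hn
  have hn' : (1 : ℝ) < n := Nat.one_lt_cast.2 hn
  have h0 : (0 : ℝ) < 1 / (n : ℝ) := by positivity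
  have h1 : 1 / (n : ℝ) < 1 := (div_lt_one (by positivity)).2 hn'
  have hcH : Continuous (powTail k F) := continuous_const.sub ((continuous_const.sub hc).pow k)
  have := apply_quantile (isDF_powTail hF hk) hcH (y := 1 - 1 / (n : ℝ))
    (by linarith) (by linarith)
  exact sub_right_injective (b := (1 : ℝ)) this

lemma isNormedLimit_powTail_frechet (hF : IsDF F) (hc : Continuous F) {k : ℕ} (hk : k ≠ 0)
    {α : ℝ} (hα : 0 < α)
    (h : TailLimit (fun x => 1 - F x) (fun x => x ^ (-α)) (Set.Ioi 0) a b) :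
    IsNormedLimit (powTail k F) (frechet (k * α))
      (fun n => quantile F (1 - (1 / (n : ℝ)) ^ (1 / (k : ℝ)))) (fun _ => 0) := by
  have hpow := tail_quantile_pow_eq hF hc hk
  set t : ℕ → ℝ := fun n => quantile F (1 - (1 / (n : ℝ)) ^ (1 / (k : ℝ)))
  have ht := tendsto_tail_of_pow_eq hF hk hpow
  have htpos : ∀ᶠ n in atTop, 0 < t n := by
    filter_upwards [(tendsto_nhdsWithin_iff.1 ht).1.eventually_lt_const (h.frechet_tail_pos hα 0)]
      with n hn using hF.antitone_tail.reflect_lt hn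
  refine ⟨htpos, fun x _ => ?_⟩
  rcases le_or_gt x 0 with hx | hx
  · -- to the left of `0` the base of the power stays below `H_k 0 < 1`
    rw [frechet_of_nonpos _ hx]
    have hH := isDF_powTail hF hk
    have hlt : powTail k F 0 < 1 := sub_lt_self 1 (pow_pos (h.frechet_tail_pos hα 0) k)
    refine tendsto_of_tendsto_of_tendsto_of_le_of_le' tendsto_const_nhds
      (tendsto_pow_atTop_nhds_zero_of_lt_one (hH.nonneg 0) hlt)
      (Eventually.of_forall fun n => pow_nonneg (hH.nonneg _) n) ?_
    filter_upwards [htpos] with n hn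
    refine pow_le_pow_left₀ (hH.nonneg _) (hH.mono ?_) n
    rw [add_zero]
    exact mul_nonpos_of_nonneg_of_nonpos hn.le hx
  · rw [frechet_of_pos _ hx, mul_comm, ← neg_mul, Real.rpow_mul_natCast hx.le]
    exact tendsto_powTail_pow hpow (by simpa only [add_zero] using h.frechet_ratio hα ht hx)

lemma lt_toReal_rightEnd_iff (hF : IsDF F) (hc : Continuous F) (hr : rightEnd F < ⊤) (x : ℝ) :
    x < (rightEnd F).toReal ↔ 0 < 1 - F x := by
  rw [sub_pos, ← lt_rightEnd_iff hF hc]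
  conv_rhs => rw [← EReal.coe_toReal hr.ne (bot_lt_rightEnd hF).ne']
  exact EReal.coe_lt_coe_iff.symm

lemma TailLimit.rightEnd_lt_top (hF : IsDF F) (hc : Continuous F) {α : ℝ} (hα : 0 < α)
    (h : TailLimit (fun x => 1 - F x) (fun x => (-x) ^ α) (Set.Iio 0) a b) :
    rightEnd F < ⊤ := by
  obtain ⟨n, hn⟩ := (h.weibull_tail_nonpos hα one_pos).exists
  refine lt_of_le_of_lt (le_of_not_gt fun hlt => ?_) (EReal.coe_lt_top (b n + 1 * a n))
  linarith [(lt_rightEnd_iff hF hc).1 hlt]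

lemma isNormedLimit_powTail_weibull (hF : IsDF F) (hc : Continuous F) {k : ℕ} (hk : k ≠ 0)
    {α : ℝ} (hα : 0 < α)
    (h : TailLimit (fun x => 1 - F x) (fun x => (-x) ^ α) (Set.Iio 0) a b) :
    IsNormedLimit (powTail k F) (weibull (k * α))
      (fun n => (rightEnd F).toReal - quantile F (1 - (1 / (n : ℝ)) ^ (1 / (k : ℝ))))
      (fun _ => (rightEnd F).toReal) := by
  have hr := lt_toReal_rightEnd_iff hF hc (h.rightEnd_lt_top hF hc hα)
  have hpow := tail_quantile_pow_eq hF hc hk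
  set r := (rightEnd F).toReal
  set t : ℕ → ℝ := fun n => quantile F (1 - (1 / (n : ℝ)) ^ (1 / (k : ℝ)))
  have ht := tendsto_tail_of_pow_eq hF hk hpow
  have htr : ∀ᶠ n in atTop, 0 < r - t n := by
    filter_upwards [ht.eventually self_mem_nhdsWithin] with n hn using sub_pos.2 ((hr _).2 hn)
  refine ⟨htr, fun x _ => ?_⟩
  rcases lt_or_ge x 0 with hx | hx
  · rw [weibull_of_neg _ hx, mul_comm, Real.rpow_mul_natCast (by linarith)]
    exact tendsto_powTail_pow hpow (h.weibull_ratio hα hr ht hx)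
  · rw [weibull_of_nonneg _ hx]
    refine tendsto_const_nhds.congr' ?_
    filter_upwards [htr] with n hn
    have hle : r ≤ (r - t n) * x + r := le_add_of_nonneg_left (mul_nonneg hn.le hx)
    have h0 : 1 - F ((r - t n) * x + r) = 0 :=
      le_antisymm (not_lt.1 fun hlt => ((hr _).2 hlt).not_ge hle) (sub_nonneg.2 (hF.le_one _))
    rw [powTail, h0, zero_pow hk, sub_zero, one_pow]

lemma isNormedLimit_powTail_gumbel (hF : IsDF F) (hc : Continuous F) {k : ℕ} (hk : k ≠ 0)
    (h : TailLimit (fun x => 1 - F x) (fun x => Real.exp (-x)) Set.univ a b) {v : ℝ → ℝ}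
    (hv : IsAuxiliary F v) :
    IsNormedLimit (powTail k F) gumbel
      (fun n => v (quantile (powTail k F) (1 - 1 / (n : ℝ))) / k)
      (fun n => quantile (powTail k F) (1 - 1 / (n : ℝ))) := by
  have hpow := tail_quantile_powTail_pow_eq hF hc hk
  set t : ℕ → ℝ := fun n => quantile (powTail k F) (1 - 1 / (n : ℝ))
  have ht := tendsto_tail_of_pow_eq hF hk hpow
  have hk0 : (0 : ℝ) < k := by positivity
  refine ⟨?_, fun x _ => ?_⟩
  · filter_upwards [ht.eventually self_mem_nhdsWithin] with n hn
    exact div_pos (hv.1 _ ((lt_rightEnd_iff hF hc).2 (sub_pos.1 hn))) hk0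
  · have := tendsto_powTail_pow hpow
      ((hv.tendsto_ratio hF hc h (x / k)).comp (tendsto_toRightEnd hF hc ht))
    rw [← Real.exp_nat_mul, mul_neg, mul_div_cancel₀ x hk0.ne'] at this
    refine this.congr fun n => ?_
    congr 2
    ring

end ExtremeValue

theorem mainTheorem2 (F f : ℝ → ℝ) (hF : IsDF F) (hf : IsPDF F f) (k : ℕ) (hk : 1 ≤ k) :
    IsDF (powTail k F) ∧
    IsPDF (powTail k F) (powTailDensity k F f) ∧
    (∀ᵐ x, HasDerivAt (powTail k F) (powTailDensity k F f x) x) ∧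
    (∀ x, HasDerivAt F (f x) x → HasDerivAt (powTail k F) (powTailDensity k F f x) x) ∧
    rightEnd (powTail k F) = rightEnd F ∧
    (∀ α : ℝ, 0 < α → F ∈ maxDomain (frechet α) →
      rightEnd (powTail k F) = rightEnd F ∧ rightEnd F = ⊤ ∧
      powTail k F ∈ maxDomain (frechet (k * α)) ∧
      IsNormedLimit (powTail k F) (frechet (k * α))
        (fun n => quantile F (1 - (1 / (n : ℝ)) ^ (1 / (k : ℝ))))
        (fun _ => 0)) ∧
    (∀ α : ℝ, 0 < α → F ∈ maxDomain (weibull α) →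
      rightEnd (powTail k F) = rightEnd F ∧ rightEnd F < ⊤ ∧
      powTail k F ∈ maxDomain (weibull (k * α)) ∧
      IsNormedLimit (powTail k F) (weibull (k * α))
        (fun n => (rightEnd F).toReal - quantile F (1 - (1 / (n : ℝ)) ^ (1 / (k : ℝ))))
        (fun _ => (rightEnd F).toReal)) ∧
    (F ∈ maxDomain gumbel →
      rightEnd (powTail k F) = rightEnd F ∧
      powTail k F ∈ maxDomain gumbel ∧
      (∃ v : ℝ → ℝ, IsAuxiliary F v) ∧
      ∀ v : ℝ → ℝ, IsAuxiliary F v →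
        IsNormedLimit (powTail k F) gumbel
          (fun n => v (quantile (powTail k F) (1 - 1 / (n : ℝ))) / k)
          (fun n => quantile (powTail k F) (1 - 1 / (n : ℝ)))) := by
  have hk0 : k ≠ 0 := Nat.one_le_iff_ne_zero.1 hk
  have hc := hf.continuous
  have hH := isDF_powTail hF hk0
  have hend := rightEnd_powTail hF hk0
  refine ⟨hH, isPDF_powTail hF hf hk0,
    hf.ae_hasDerivAt.mono fun x hx => hasDerivAt_powTail k hx,
    fun x hx => hasDerivAt_powTail k hx, hend, ?_, ?_, ?_⟩
  · rintro α hα ⟨-, -, -, a, b, hab⟩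
    have hT := hab.tailLimit hF isOpen_Ioi (continuousOn_rpow_neg α)
      fun x hx => frechet_of_pos α hx
    have hlim := isNormedLimit_powTail_frechet hF hc hk0 hα hT
    refine ⟨hend, EReal.eq_top_iff_forall_lt _ |>.2 fun x => (lt_rightEnd_iff hF hc).2 ?_,
      ⟨hH, isDF_frechet (by positivity), exists_frechet_mem_Ioo _, _, _, hlim⟩, hlim⟩
    exact sub_pos.1 (hT.frechet_tail_pos hα x)
  · rintro α hα ⟨-, -, -, a, b, hab⟩
    have hT := hab.tailLimit hF isOpen_Iio (continuousOn_neg_rpow hα)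
      fun x hx => weibull_of_neg α hx
    have hlim := isNormedLimit_powTail_weibull hF hc hk0 hα hT
    exact ⟨hend, hT.rightEnd_lt_top hF hc hα,
      ⟨hH, isDF_weibull (by positivity), exists_weibull_mem_Ioo _, _, _, hlim⟩, hlim⟩
  · rintro ⟨-, hG, hnd, a, b, hab⟩
    have hT := hab.tailLimit hF isOpen_univ continuousOn_exp_neg fun x _ => rfl
    have hlim (v : ℝ → ℝ) (hv : IsAuxiliary F v) :=
      isNormedLimit_powTail_gumbel hF hc hk0 hT hv
    obtain ⟨v, hv⟩ := hT.exists_isAuxiliary hF hc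
    exact ⟨hend, ⟨hH, hG, hnd, _, _, hlim v hv⟩, ⟨v, hv⟩, hlim⟩
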